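/- Let $n\ge 1$, let $\mathbb{B}^n=\{z\in\mathbb{C}^n:\|z\|<1\}$ be the open unit ball for the Euclidean norm, let $d\sigma$ be the normalized Lebesgue surface measure on $\partial\mathbb{B}^n$, let $dV_N$ be the normalized Lebesgue volume measure on $\mathbb{B}^n$, and let $d(z)$ be the Euclidean distance from $z$ to $\partial\mathbb{B}^n$. For $0<p\le\infty$ the generalized Hardy space $\mathcal{H}_g^p(\mathbb{B}^n)$ consists of the measurable functions $f:\mathbb{B}^n\to\mathbb{C}$ for which, when $p<\infty$, the integral means $M_p(r,f)=\left(\int_{\partial\mathbb{B}^n}|f(r\zeta)|^p\,d\sigma(\zeta)\right)^{1/p}$ exist for all $r\in(0,1)$ and $\sup_{0<r<1}M_p(r,f)<\infty$, and, when $p=\infty$, $\sup_{z\in\mathbb{B}^n}|f(z)|<\infty$. For $\nu>-1$ and $0<\mu<\infty$ the Bergman-type space $b_{\nu,\mu}(\mathbb{B}^n)$ consists of the continuous functions $f:\mathbb{B}^n\to\mathbb{C}$ with $$\|f\|_{b_{\nu,\mu}}=|f(0)|+\left(\int_{\mathbb{B}^n}d(z)^{\nu}|f(z)|^{\mu}\,dV_N(z)\right)^{1/\mu}<\infty.$$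 Let $\lambda_1,\dots,\lambda_n$ be real constants with $\sum_{k=1}^n\lambda_k^2\neq0$, let $\alpha\ge0$ and $p>\max\{2,(\alpha-2)^2/4\}$ be real numbers, and let $f\in\mathcal{H}_g^p(\mathbb{B}^n)$ be twice continuously differentiable (in the real sense) on $\mathbb{B}^n$ and satisfy, for every $k\in\{1,\dots,n\}$, $$\frac{\partial f}{\partial\overline{z}_k}=\lambda_k|f|^{\alpha}\quad\text{on }\mathbb{B}^n,$$ where $\partial/\partial\overline{z}_k=\frac12\left(\partial/\partial x_k+i\,\partial/\partial y_k\right)$, $z_k=x_k+iy_k$, and $|f|^0=1$. Then $f\in b_{1,\vartheta}(\mathbb{B}^n)$, where $\vartheta=p+2\alpha-2$. -/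

import Mathlib

open MeasureTheory Metric
open scoped ENNReal

noncomputable section

/-- The complex Euclidean space `ℂⁿ`, with its Euclidean norm. -/
abbrev Cn (n : ℕ) : Type := EuclideanSpace ℂ (Fin n)

/-- The open unit ball `𝔹ⁿ` of `ℂⁿ`. -/
def unitBall (n : ℕ) : Set (Cn n) := ball 0 1

/-- Lebesgue measure on `𝔹ⁿ`, normalized to have total mass one. -/
def volN (n : ℕ) : Measure (Cn n) :=
  (volume (unitBall n))⁻¹ • volume.restrict (unitBall n)

/-- Lebesgue surface measure on the unit sphere `∂𝔹ⁿ`, normalized to have total mass one. -/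
def surfN (n : ℕ) : Measure (sphere (0 : Cn n) 1) :=
  ((volume : Measure (Cn n)).toSphere Set.univ)⁻¹ • (volume : Measure (Cn n)).toSphere

/-- The Wirtinger derivative `∂f/∂z̄ₖ = (1/2) (∂f/∂xₖ + i ∂f/∂yₖ)`, where `zₖ = xₖ + i yₖ`. -/
def dzbar {n : ℕ} (k : Fin n) (f : Cn n → ℂ) (z : Cn n) : ℂ :=
  (1 / 2 : ℂ) * (lineDeriv ℝ f z (EuclideanSpace.single k (1 : ℂ))
    + Complex.I * lineDeriv ℝ f z (EuclideanSpace.single k Complex.I))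

/-- The integral mean `M_p(r, f) = (∫_{∂𝔹ⁿ} |f(rζ)|^p dσ(ζ))^{1/p}`, with values in `[0, ∞]`. -/
def integralMean {n : ℕ} (p r : ℝ) (f : Cn n → ℂ) : ℝ≥0∞ :=
  (∫⁻ ζ : sphere (0 : Cn n) 1, ‖f (r • (ζ : Cn n))‖ₑ ^ p ∂(surfN n)) ^ (1 / p)

/-- The norm of the generalized Hardy space: `sup_{0<r<1} M_p(r, f)` for `p < ∞`, and
`sup_{z ∈ 𝔹ⁿ} |f(z)|` for `p = ∞`. -/
def hardyNorm {n : ℕ} (p : ℝ≥0∞) (f : Cn n → ℂ) : ℝ≥0∞ :=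
  if p = ∞ then ⨆ z ∈ unitBall n, ‖f z‖ₑ
  else ⨆ r ∈ Set.Ioo (0 : ℝ) 1, integralMean p.toReal r f

/-- `f` belongs to the generalized Hardy space `H_g^p(𝔹ⁿ)`, `0 < p ≤ ∞`: it is (Lebesgue)
measurable on `𝔹ⁿ`, its integral means over the spheres of radius `0 < r < 1` make sense, and its
norm is finite. Only the values of `f` on `𝔹ⁿ` matter. -/
structure MemHardy {n : ℕ} (p : ℝ≥0∞) (f : Cn n → ℂ) : Prop where
  measurable : AEStronglyMeasurable f (volume.restrict (unitBall n))
  mean_exists : p ≠ ∞ → ∀ r ∈ Set.Ioo (0 : ℝ) 1,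
    AEStronglyMeasurable (fun ζ : sphere (0 : Cn n) 1 => f (r • (ζ : Cn n))) (surfN n)
  norm_lt_top : hardyNorm p f < ∞

/-- The distance `d(z)` from `z` to the boundary of `𝔹ⁿ`. -/
def bdryDist {n : ℕ} (z : Cn n) : ℝ := infDist z (frontier (unitBall n))

/-- The norm `|f(0)| + (∫_{𝔹ⁿ} d(z)^ν |f(z)|^μ dV_N(z))^{1/μ}` of the Bergman-type space
`b_{ν,μ}(𝔹ⁿ)`, with values in `[0, ∞]`. -/
def bergmanNorm {n : ℕ} (ν μ : ℝ) (f : Cn n → ℂ) : ℝ≥0∞ :=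
  ‖f 0‖ₑ + (∫⁻ z, ENNReal.ofReal (bdryDist z ^ ν * ‖f z‖ ^ μ) ∂(volN n)) ^ (1 / μ)

/-- `f` belongs to the Bergman-type space `b_{ν,μ}(𝔹ⁿ)`, `ν > -1`, `μ > 0`: it is continuous on
`𝔹ⁿ` and its norm is finite. -/
structure MemBergman {n : ℕ} (ν μ : ℝ) (f : Cn n → ℂ) : Prop where
  continuousOn : ContinuousOn f (unitBall n)
  norm_lt_top : bergmanNorm ν μ f < ∞

end

/-! The engine is the subharmonic-type estimate `Δ|f|^p ≥ (4p - (α-2)²) (∑ λ_k²) |f|^(p+2α-2)` on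
the ball, with positive constant since `p > (α-2)²/4`. It is proved one complex direction at a time
(`normRpowSndDeriv_add_ge`): differentiating the equation expresses each block of `Δf` through first
derivatives, and what remains is a quadratic form (`laplacian_form_lower_bound`). Since `p > 2`,
`|f|^p` is C² even across zeros of `f`.

Green's formula is applied on the whole space with the test function `H(1-‖z‖²)`, where `H` is a
convex approximation of the positive part that vanishes near the boundary and beyond, so no boundary
terms appear. In `Δ[H(1-‖z‖²)] = 4‖z‖² H'' - 4n H'` the second term has a favourable sign and is
dropped (`integral_radial_mul_norm_rpow_le`). In polar coordinates the spherical means of `|f|^p`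
are bounded by the Hardy norm, and the radial mass of `4t² H''(1-t²)` is at most 2 because `0 ≤ H' ≤
1`. The bound is uniform in the cutoff; Fatou's lemma gives finiteness with weight `1-‖z‖²`, which
dominates the boundary distance. -/

/-! ### Integration by parts with compactly supported factors -/

open Filter Topology Set in
/-- A product with a compactly supported factor is continuous as soon as the other factor is
continuous near the support. -/
theorem continuous_mul_of_eq_zero_off_compact {E : Type*} [TopologicalSpace E] [T2Space E]
    {φ h : E → ℝ} {K U : Set E} (hK : IsCompact K) (hU : IsOpen U) (hKU : K ⊆ U)
    (hφ : Continuous φ) (h0 : ∀ x ∉ K, φ x = 0) (hh : ContinuousOn h U) :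
    Continuous (fun x => φ x * h x) := by
  rw [continuous_iff_continuousAt]
  intro x
  by_cases hx : x ∈ U
  · exact hφ.continuousAt.mul (hh.continuousAt (hU.mem_nhds hx))
  · have hxK : x ∉ K := fun h => hx (hKU h)
    have : (fun x => φ x * h x) =ᶠ[𝓝 x] fun _ => 0 := by
      filter_upwards [hK.isClosed.isOpen_compl.mem_nhds hxK] with y hy
      simp [h0 y hy]
    exact continuousAt_const.congr this.symm

theorem integrable_mul_of_eq_zero_off_compact {E : Type*} [NormedAddCommGroup E]
    [MeasurableSpace E] [BorelSpace E] {μ : Measure E} [IsFiniteMeasureOnCompacts μ]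
    {φ h : E → ℝ} {K U : Set E} (hK : IsCompact K) (hU : IsOpen U) (hKU : K ⊆ U)
    (hφ : Continuous φ) (h0 : ∀ x ∉ K, φ x = 0) (hh : ContinuousOn h U) :
    Integrable (fun x => φ x * h x) μ :=
  (continuous_mul_of_eq_zero_off_compact hK hU hKU hφ h0 hh).integrable_of_hasCompactSupport
    (HasCompactSupport.intro hK fun x hx => by simp [h0 x hx])

section IntegrationByParts

variable {E : Type*} [NormedAddCommGroup E] [NormedSpace ℝ E] [FiniteDimensional ℝ E]
  [MeasurableSpace E] [BorelSpace E]

/-- Integration by parts against a compactly supported function. -/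
theorem integral_mul_lineDeriv_eq_neg {μ : Measure E} [μ.IsAddHaarMeasure]
    {φ φ' h h' : E → ℝ} {e : E} {K U : Set E} (hK : IsCompact K) (hU : IsOpen U) (hKU : K ⊆ U)
    (hφc : Continuous φ) (hφc' : Continuous φ')
    (h0 : ∀ x ∉ K, φ x = 0) (h0' : ∀ x ∉ K, φ' x = 0)
    (hφ : ∀ x, HasLineDerivAt ℝ φ (φ' x) x e)
    (hhc : ContinuousOn h U) (hhc' : ContinuousOn h' U)
    (hh : ∀ x ∈ U, HasLineDerivAt ℝ h (h' x) x e) :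
    ∫ x, φ x * h' x ∂μ = - ∫ x, φ' x * h x ∂μ := by
  have hts : tsupport φ ⊆ U :=
    (closure_minimal (Function.support_subset_iff'.2 h0) hK.isClosed).trans hKU
  exact integral_bilinear_hasLineDerivAt_right_eq_neg_left_of_integrable
    (B := ContinuousLinearMap.mul ℝ ℝ)
    (integrable_mul_of_eq_zero_off_compact hK hU hKU hφc' h0' hhc)
    (integrable_mul_of_eq_zero_off_compact hK hU hKU hφc h0 hhc')
    (integrable_mul_of_eq_zero_off_compact hK hU hKU hφc h0 hhc)
    (fun x _ => hφ x) (fun x hx => hh x (hts hx))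

/-- Double integration by parts against a compactly supported function. -/
theorem integral_mul_lineDeriv_lineDeriv {μ : Measure E} [μ.IsAddHaarMeasure]
    {φ φ₁ φ₂ h h₁ h₂ : E → ℝ} {e : E} {K U : Set E}
    (hK : IsCompact K) (hU : IsOpen U) (hKU : K ⊆ U)
    (hφc : Continuous φ) (hφc₁ : Continuous φ₁) (hφc₂ : Continuous φ₂)
    (h0 : ∀ x ∉ K, φ x = 0) (h0₁ : ∀ x ∉ K, φ₁ x = 0) (h0₂ : ∀ x ∉ K, φ₂ x = 0)
    (hφ : ∀ x, HasLineDerivAt ℝ φ (φ₁ x) x e) (hφ₁ : ∀ x, HasLineDerivAt ℝ φ₁ (φ₂ x) x e)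
    (hhc : ContinuousOn h U) (hhc₁ : ContinuousOn h₁ U) (hhc₂ : ContinuousOn h₂ U)
    (hh : ∀ x ∈ U, HasLineDerivAt ℝ h (h₁ x) x e)
    (hh₁ : ∀ x ∈ U, HasLineDerivAt ℝ h₁ (h₂ x) x e) :
    ∫ x, φ x * h₂ x ∂μ = ∫ x, φ₂ x * h x ∂μ := by
  rw [integral_mul_lineDeriv_eq_neg hK hU hKU hφc hφc₁ h0 h0₁ hφ hhc₁ hhc₂ hh₁,
    integral_mul_lineDeriv_eq_neg hK hU hKU hφc₁ hφc₂ h0₁ h0₂ hφ₁ hhc hhc₁ hh, neg_neg]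

end IntegrationByParts

/-! ### Second derivative of `‖γ‖ ^ p` along a curve -/

section NormRpow

open Filter Topology
open scoped RealInnerProductSpace

variable {F : Type*} [NormedAddCommGroup F] [InnerProductSpace ℝ F]

/-- The second derivative of `‖γ‖ ^ p` along a curve with position `x`, velocity `v` and
acceleration `a`. -/
noncomputable def normRpowSndDeriv (p : ℝ) (x v a : F) : ℝ :=
  p * ‖x‖ ^ (p - 2) * (‖v‖ ^ 2 + ⟪x, a⟫) + p * (p - 2) * (⟪‖x‖ ^ ((p - 4) / 2) • x, v⟫) ^ 2

theorem normRpowSndDeriv_zero {p : ℝ} (hp : 2 < p) (v a : F) :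
    normRpowSndDeriv p 0 v a = 0 := by
  simp [normRpowSndDeriv, Real.zero_rpow (sub_pos.2 hp).ne']

/-- The norm is `‖x‖ ^ (s + 1)` off the origin, which tends to zero there. With `s = (p - 4) / 2`
the condition is exactly `p > 2`; this is why `normRpowSndDeriv` keeps the weight inside the square
instead of factoring out `‖x‖ ^ (p - 4)`, possibly singular at zero. -/
theorem continuous_norm_rpow_smul {s : ℝ} (hs : -1 < s) :
    Continuous fun x : F => ‖x‖ ^ s • x := by
  rw [continuous_iff_continuousAt]
  intro x
  by_cases hx : x = 0
  · subst hx
    have hs' : 0 < s + 1 := by linarith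
    have h1 : Tendsto (fun x : F => ‖x‖ ^ (s + 1)) (𝓝 0) (𝓝 0) := by
      have := (continuous_norm (E := F)).tendsto 0 |>.rpow_const (p := s + 1) (Or.inr hs'.le)
      simpa [Real.zero_rpow hs'.ne'] using this
    unfold ContinuousAt
    beta_reduce
    rw [smul_zero]
    refine squeeze_zero_norm (fun y => ?_) h1
    rw [norm_smul, Real.norm_of_nonneg (by positivity)]
    rcases eq_or_ne y 0 with rfl | hy
    · simp [Real.zero_rpow hs'.ne']
    · rw [Real.rpow_add_one (norm_ne_zero_iff.2 hy)]
  · exact (continuousAt_id.norm.rpow_const (Or.inl (norm_ne_zero_iff.2 hx))).smul continuousAt_id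

theorem ContinuousOn.normRpowSndDeriv {X : Type*} [TopologicalSpace X] {p : ℝ} (hp : 2 < p)
    {u v w : X → F} {s : Set X} (hu : ContinuousOn u s) (hv : ContinuousOn v s)
    (hw : ContinuousOn w s) :
    ContinuousOn (fun x => _root_.normRpowSndDeriv p (u x) (v x) (w x)) s := by
  have h1 : ContinuousOn (fun x => ‖u x‖ ^ ((p - 4) / 2) • u x) s :=
    (continuous_norm_rpow_smul (by linarith)).comp_continuousOn hu
  have h2 : ContinuousOn (fun x => ‖u x‖ ^ (p - 2)) s :=
    hu.norm.rpow_const fun _ _ => Or.inr (by linarith)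
  unfold _root_.normRpowSndDeriv
  fun_prop

theorem HasDerivAt.norm_rpow_of_one_lt {p : ℝ} (hp : 1 < p) {γ : ℝ → F} {γ' : F} {t : ℝ}
    (h : HasDerivAt γ γ' t) :
    HasDerivAt (fun s => ‖γ s‖ ^ p) (p * ‖γ t‖ ^ (p - 2) * ⟪γ t, γ'⟫) t := by
  have := (hasFDerivAt_norm_rpow (γ t) hp).comp_hasDerivAt t h
  rwa [_root_.smul_apply, innerSL_apply_apply, smul_eq_mul] at this

/-- Serves at zeros of the curve, where `‖γ‖ ^ (p - 2)` is continuous but need not be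
differentiable, so the product rule is unavailable. -/
theorem hasDerivAt_mul_of_eq_zero {a b : ℝ → ℝ} {b' t : ℝ} (ha : ContinuousAt a t)
    (ha0 : a t = 0) (hb : HasDerivAt b b' t) (hb0 : b t = 0) :
    HasDerivAt (fun s => a s * b s) 0 t := by
  rw [hasDerivAt_iff_tendsto_slope] at hb ⊢
  have h1 : Tendsto (fun s => a s * slope b t s) (𝓝[≠] t) (𝓝 (0 * b')) :=
    (ha0 ▸ ha.tendsto.mono_left nhdsWithin_le_nhds).mul hb
  rw [zero_mul] at h1
  refine h1.congr fun s => ?_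
  simp only [slope_def_field, hb0]
  ring

theorem hasDerivAt_norm_rpow_mul_inner {p : ℝ} (hp : 2 < p) {γ γ₁ : ℝ → F} {γ₂ : F} {t : ℝ}
    (h : HasDerivAt γ (γ₁ t) t) (h₁ : HasDerivAt γ₁ γ₂ t) :
    HasDerivAt (fun s => p * ‖γ s‖ ^ (p - 2) * ⟪γ s, γ₁ s⟫)
      (normRpowSndDeriv p (γ t) (γ₁ t) γ₂) t := by
  have hin : HasDerivAt (fun s => ⟪γ s, γ₁ s⟫) (⟪γ t, γ₂⟫ + ⟪γ₁ t, γ₁ t⟫) t := h.inner ℝ h₁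
  by_cases hx : γ t = 0
  · rw [hx, normRpowSndDeriv_zero hp]
    refine hasDerivAt_mul_of_eq_zero ?_ ?_ hin (by simp [hx])
    · exact continuousAt_const.mul (h.continuousAt.norm.rpow_const (Or.inr (by linarith)))
    · simp [hx, Real.zero_rpow (sub_pos.2 hp).ne']
  · have hn : 0 < ‖γ t‖ := norm_pos_iff.2 hx
    have hnorm : HasDerivAt (fun s => ‖γ s‖ ^ (p - 2))
        ((p - 2) * ‖γ t‖ ^ (p - 4) * ⟪γ t, γ₁ t⟫) t := by
      have h2 : HasDerivAt (fun s => (‖γ s‖ ^ 2) ^ ((p - 2) / 2))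
          ((2 * ⟪γ t, γ₁ t⟫) * ((p - 2) / 2) * (‖γ t‖ ^ 2) ^ ((p - 2) / 2 - 1)) t :=
        h.norm_sq.rpow_const (Or.inl (by positivity))
      convert h2 using 1
      · ext s
        rw [← Real.rpow_natCast_mul (norm_nonneg _)]
        congr 1; push_cast; ring
      · rw [← Real.rpow_natCast_mul (norm_nonneg _),
          show ((2 : ℕ) : ℝ) * ((p - 2) / 2 - 1) = p - 4 by push_cast; ring]
        ring
    refine ((hnorm.const_mul p).mul hin).congr_deriv ?_
    have h4 : (‖γ t‖ ^ ((p - 4) / 2)) ^ 2 = ‖γ t‖ ^ (p - 4) := by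
      rw [← Real.rpow_mul_natCast (norm_nonneg _)]
      congr 1; push_cast; ring
    unfold normRpowSndDeriv
    rw [real_inner_smul_left, mul_pow, h4, real_inner_self_eq_norm_sq]
    ring

end NormRpow

/-! ### The convex cutoff -/

/-- A convex `C²` approximation of the positive part, vanishing up to `ε`. -/
theorem exists_convex_cutoff {ε : ℝ} (hε : 0 < ε) :
    ∃ H H₁ H₂ : ℝ → ℝ, (∀ s, HasDerivAt H (H₁ s) s) ∧ (∀ s, HasDerivAt H₁ (H₂ s) s) ∧
      Continuous H₂ ∧ (∀ s, 0 ≤ H s) ∧ (∀ s, 0 ≤ H₁ s ∧ H₁ s ≤ 1) ∧ (∀ s, 0 ≤ H₂ s) ∧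
      (∀ s ≤ ε, H s = 0 ∧ H₁ s = 0 ∧ H₂ s = 0) ∧ (∀ s, s - 2 * ε ≤ H s) ∧
      (∀ s, 0 ≤ s → H s ≤ s) := by
  -- `χ` climbs from 0 at `ε` to 1 at `2ε`; the cutoff is its primitive based at `ε`.
  set χ : ℝ → ℝ := fun s => Real.smoothTransition (ε⁻¹ * s - 1) with hχ
  have hχd : ContDiff ℝ 1 χ := Real.smoothTransition.contDiff.comp (by fun_prop)
  have hχm : Monotone χ := fun a b hab => Real.smoothTransition.monotone (by gcongr)
  have hχ0 : ∀ s, 0 ≤ χ s := fun s => Real.smoothTransition.nonneg _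
  have hχ1 : ∀ s, χ s ≤ 1 := fun s => Real.smoothTransition.le_one _
  have hχz : ∀ s ≤ ε, χ s = 0 := fun s hs => Real.smoothTransition.zero_of_nonpos (by
    rw [sub_nonpos, inv_mul_le_iff₀ hε]; linarith)
  have hχo : ∀ s, 2 * ε ≤ s → χ s = 1 := fun s hs => Real.smoothTransition.one_of_one_le (by
    rw [le_sub_iff_add_le, le_inv_mul_iff₀ hε]; linarith)
  have hχc : Continuous χ := hχd.continuous
  have hint : ∀ a b, IntervalIntegrable χ volume a b := fun a b => hχc.intervalIntegrable a b
  have hHz : ∀ s ≤ ε, ∫ x in (ε)..s, χ x = 0 := fun s hs => by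
    rw [intervalIntegral.integral_congr (g := fun _ => (0 : ℝ))]
    · simp
    · intro x hx
      rw [Set.uIcc_of_ge hs] at hx
      exact hχz x hx.2
  have hH0 : ∀ s, 0 ≤ ∫ x in (ε)..s, χ x := fun s => by
    rcases le_total s ε with h | h
    · rw [hHz s h]
    · exact intervalIntegral.integral_nonneg h fun x _ => hχ0 x
  refine ⟨fun s => ∫ x in (ε)..s, χ x, χ, deriv χ,
    fun s => (hχc.integral_hasStrictDerivAt ε s).hasDerivAt,
    fun s => (hχd.differentiable one_ne_zero s).hasDerivAt,
    hχd.continuous_deriv le_rfl, hH0, fun s => ⟨hχ0 s, hχ1 s⟩, fun s => hχm.deriv_nonneg,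
    fun s hs => ⟨hHz s hs, hχz s hs, ?_⟩, fun s => ?_, fun s hs => ?_⟩
  -- The minimum argument covers the endpoint `s = ε`, where `χ` is not locally zero a priori.
  · exact IsLocalMin.deriv_eq_zero (Filter.Eventually.of_forall fun x => by
      rw [hχz s hs]; exact hχ0 x)
  · rcases le_total s (2 * ε) with h | h
    · exact le_trans (by linarith) (hH0 s)
    · have h1 : ∫ x in (2 * ε)..s, χ x = s - 2 * ε := by
        rw [intervalIntegral.integral_congr (g := fun _ => (1 : ℝ))]
        · simp
        · intro x hx
          rw [Set.uIcc_of_le h] at hx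
          exact hχo x hx.1
      have h2 := intervalIntegral.integral_add_adjacent_intervals (hint ε (2 * ε)) (hint (2 * ε) s)
      have h3 := hH0 (2 * ε)
      simp only at h3 ⊢
      linarith
  · rcases le_total s ε with h | h
    · exact (hHz s h).trans_le hs
    · have := intervalIntegral.integral_mono_on h (hint ε s)
        (intervalIntegrable_const (c := (1 : ℝ))) fun x _ => hχ1 x
      simp at this ⊢
      linarith

/-! ### Pointwise lower bound for the Laplacian of `|f| ^ p` -/

section Pointwise

open Filter Topology
open scoped RealInnerProductSpace

/-- Here `a + ib` stands for `f`, the `x` and `y` for its two partial derivatives, `B` for `c|f|^α`.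
In terms of `P = ⟪f, f_x⟫`, `Q = ⟪f, f_y⟫` and `τ = (aP - bQ)/R`, the form is `p (P² + Q²)/R +
2(α-2)Bτ + 4B²`. Cauchy–Schwarz replaces the first term by `pτ²`, and completing the square in `τ`
leaves the stated constant. -/
theorem laplacian_form_lower_bound {p α a b x₁ x₂ y₁ y₂ B R : ℝ} (hp : 0 < p)
    (hR : R = a ^ 2 + b ^ 2) (hR0 : 0 < R) (h1 : x₁ - y₂ = 2 * B) (h2 : x₂ + y₁ = 0) :
    (4 - (α - 2) ^ 2 / p) * B ^ 2 ≤ x₁ ^ 2 + x₂ ^ 2 + (y₁ ^ 2 + y₂ ^ 2)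
      + 2 * α * B / R * (a * (a * x₁ + b * x₂) - b * (a * y₁ + b * y₂))
      + (p - 2) / R * ((a * x₁ + b * x₂) ^ 2 + (a * y₁ + b * y₂) ^ 2) := by
  obtain rfl : x₂ = -y₁ := by linarith
  obtain rfl : x₁ = 2 * B + y₂ := by linarith
  set P := a * (2 * B + y₂) + b * -y₁ with hP
  set Q := a * y₁ + b * y₂ with hQ
  have e1 : (2 * B + y₂) ^ 2 + (-y₁) ^ 2 + (y₁ ^ 2 + y₂ ^ 2)
      = (2 * (P ^ 2 + Q ^ 2) - 4 * B * (a * P - b * Q)) / R + 4 * B ^ 2 := by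
    rw [div_add' _ _ _ hR0.ne', eq_div_iff hR0.ne', hR, hP, hQ]
    ring
  have e2 : ((a * P - b * Q) / R) ^ 2 ≤ (P ^ 2 + Q ^ 2) / R := by
    rw [div_pow, div_le_div_iff₀ (by positivity) hR0]
    have : (a * P - b * Q) ^ 2 ≤ R * (P ^ 2 + Q ^ 2) := by
      rw [hR]; nlinarith [sq_nonneg (a * Q + b * P)]
    calc _ ≤ R * (P ^ 2 + Q ^ 2) * R := by gcongr
      _ = _ := by ring
  rw [e1]
  set τ := (a * P - b * Q) / R with hτ
  have e3 : (2 * (P ^ 2 + Q ^ 2) - 4 * B * (a * P - b * Q)) / R + 4 * B ^ 2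
      + 2 * α * B / R * (a * P - b * Q) + (p - 2) / R * (P ^ 2 + Q ^ 2)
      = p * ((P ^ 2 + Q ^ 2) / R) + 2 * (α - 2) * B * τ + 4 * B ^ 2 := by
    rw [hτ]; field_simp; ring
  rw [e3]
  have e4 : p * τ ^ 2 + 2 * (α - 2) * B * τ + 4 * B ^ 2
      = p * (τ + (α - 2) * B / p) ^ 2 + (4 - (α - 2) ^ 2 / p) * B ^ 2 := by
    field_simp; ring
  have e5 : 0 ≤ p * (τ + (α - 2) * B / p) ^ 2 := by positivity
  have e6 : p * τ ^ 2 ≤ p * ((P ^ 2 + Q ^ 2) / R) := by gcongr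
  linarith

variable {E : Type*} [NormedAddCommGroup E] [NormedSpace ℝ E]

theorem ContDiffAt.differentiableAt_fderiv_apply {f : E → ℂ} {z : E} (hf : ContDiffAt ℝ 2 f z)
    (e : E) : DifferentiableAt ℝ (fun w => fderiv ℝ f w e) z :=
  ((hf.fderiv_right (m := 1) (by norm_num)).differentiableAt one_ne_zero).clm_apply
    (differentiableAt_const e)

theorem ContDiffAt.fderiv_fderiv_apply_comm {f : E → ℂ} {z : E} (hf : ContDiffAt ℝ 2 f z)
    (e e' : E) : fderiv ℝ (fun w => fderiv ℝ f w e) z e' =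
      fderiv ℝ (fun w => fderiv ℝ f w e') z e := by
  have hd : DifferentiableAt ℝ (fderiv ℝ f) z :=
    (hf.fderiv_right (m := 1) (by norm_num)).differentiableAt one_ne_zero
  have key : ∀ u v : E, fderiv ℝ (fun w => fderiv ℝ f w u) z v = fderiv ℝ (fderiv ℝ f) z v u := by
    intro u v
    rw [fderiv_clm_apply hd (differentiableAt_const u)]
    simp
  rw [key, key]
  exact hf.isSymmSndFDerivAt (by simp) e' e

/-- If `∂f/∂z̄ = c |f| ^ α` in the complex direction spanned by `e`, `e'`, the corresponding part
of the Laplacian of `|f| ^ p` is bounded below. -/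
theorem normRpowSndDeriv_add_ge {f : E → ℂ} {z : E} (hf : ContDiffAt ℝ 2 f z) (e e' : E)
    {p α c : ℝ} (hp : 2 < p) (hα : 0 ≤ α)
    (hpde : ∀ᶠ w in 𝓝 z, (1 / 2 : ℂ) * (fderiv ℝ f w e + Complex.I * fderiv ℝ f w e')
      = ((c * ‖f w‖ ^ α : ℝ) : ℂ)) :
    p * (4 - (α - 2) ^ 2 / p) * c ^ 2 * ‖f z‖ ^ (p + 2 * α - 2) ≤
      normRpowSndDeriv p (f z) (fderiv ℝ f z e) (fderiv ℝ (fun w => fderiv ℝ f w e) z e) +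
      normRpowSndDeriv p (f z) (fderiv ℝ f z e') (fderiv ℝ (fun w => fderiv ℝ f w e') z e') := by
  by_cases h0 : f z = 0
  · rw [h0, normRpowSndDeriv_zero hp, normRpowSndDeriv_zero hp, norm_zero,
      Real.zero_rpow (by linarith)]
    simp
  have hn : 0 < ‖f z‖ := norm_pos_iff.2 h0
  have hfd : HasFDerivAt f (fderiv ℝ f z) z := (hf.differentiableAt two_ne_zero).hasFDerivAt
  have hX := (hf.differentiableAt_fderiv_apply e).hasFDerivAt
  have hY := (hf.differentiableAt_fderiv_apply e').hasFDerivAt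
  have hnα : HasFDerivAt (fun w => ‖f w‖ ^ α)
      ((α * ‖f z‖ ^ (α - 2)) • (innerSL ℝ (f z)).comp (fderiv ℝ f z)) z := by
    have h2 := (hfd.norm_sq).rpow_const (p := α / 2) (Or.inl (pow_pos hn 2).ne')
    convert h2 using 1
    · ext w
      rw [← Real.rpow_natCast_mul (norm_nonneg _)]
      congr 1; push_cast; ring
    · rw [← Real.rpow_natCast_mul (norm_nonneg _),
        show ((2 : ℕ) : ℝ) * (α / 2 - 1) = α - 2 by push_cast; ring]
      ext v
      simp
      ring
  -- The equation differentiated in a direction `v`; the cases `v = e` and `v = e'` are used.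
  have hD : ∀ v, fderiv ℝ (fun w => fderiv ℝ f w e) z v
      + Complex.I * fderiv ℝ (fun w => fderiv ℝ f w e') z v
      = ((2 * c * (α * ‖f z‖ ^ (α - 2) * ⟪f z, fderiv ℝ f z v⟫) : ℝ) : ℂ) := by
    intro v
    have hl := (hX.add (hY.const_mul Complex.I))
    have hr := (Complex.ofRealCLM.hasFDerivAt.comp z (hnα.const_mul (2 * c)))
    have heq : (fun w => fderiv ℝ f w e + Complex.I * fderiv ℝ f w e') =ᶠ[𝓝 z]
        (Complex.ofRealCLM ∘ fun w => 2 * c * ‖f w‖ ^ α) := by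
      filter_upwards [hpde] with w hw
      simp only [Function.comp, Complex.ofRealCLM_apply]
      push_cast at hw ⊢
      linear_combination 2 * hw
    have := DFunLike.congr_fun (hl.unique (hr.congr_of_eventuallyEq heq)) v
    simp [mul_assoc] at this ⊢
    rw [this]
    ring
  have hXY := hf.fderiv_fderiv_apply_comm e e'
  have d1 := hD e
  have d2 := hD e'
  rw [hXY] at d2
  have hz := hpde.self_of_nhds
  unfold normRpowSndDeriv
  generalize fderiv ℝ (fun w => fderiv ℝ f w e) z e = A at *
  generalize fderiv ℝ (fun w => fderiv ℝ f w e') z e = W at *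
  generalize fderiv ℝ (fun w => fderiv ℝ f w e') z e' = D at *
  generalize fderiv ℝ f z e = X at *
  generalize fderiv ℝ f z e' = Y at *
  generalize f z = u at *
  have hin : ∀ v w : ℂ, ⟪v, w⟫ = v.re * w.re + v.im * w.im := fun v w => by
    simp [Complex.inner]; ring
  have hR : ‖u‖ ^ 2 = u.re ^ 2 + u.im ^ 2 := by
    rw [Complex.sq_norm, Complex.normSq_apply]; ring
  have hz1 := congrArg Complex.re hz
  have hz2 := congrArg Complex.im hz
  have d11 := congrArg Complex.re d1
  have d12 := congrArg Complex.im d1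
  have d21 := congrArg Complex.re d2
  have d22 := congrArg Complex.im d2
  simp at hz1 hz2 d11 d12 d21 d22
  have hmain := laplacian_form_lower_bound (p := p) (α := α) (B := c * ‖u‖ ^ α)
    (x₁ := X.re) (x₂ := X.im) (y₁ := Y.re) (y₂ := Y.im) (by linarith) hR (by positivity)
    (by linarith) (by linarith)
  have r1 : ‖u‖ ^ α = ‖u‖ ^ (α - 2) * ‖u‖ ^ 2 := by
    rw [← Real.rpow_add_natCast hn.ne']; congr 1; push_cast; ring
  have r2 : (‖u‖ ^ ((p - 4) / 2)) ^ 2 = ‖u‖ ^ (p - 2) / ‖u‖ ^ 2 := by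
    rw [← Real.rpow_mul_natCast hn.le, ← Real.rpow_sub_natCast hn.ne']
    congr 1; push_cast; ring
  have r3 : ‖u‖ ^ (p + 2 * α - 2) = ‖u‖ ^ (p - 2) * (‖u‖ ^ α) ^ 2 := by
    rw [← Real.rpow_mul_natCast hn.le, ← Real.rpow_add hn]
    congr 1; push_cast; ring
  have hX2 : ‖X‖ ^ 2 = X.re ^ 2 + X.im ^ 2 := by
    rw [Complex.sq_norm, Complex.normSq_apply]; ring
  have hY2 : ‖Y‖ ^ 2 = Y.re ^ 2 + Y.im ^ 2 := by
    rw [Complex.sq_norm, Complex.normSq_apply]; ring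
  have r4 : 2 * α * (c * ‖u‖ ^ α) / ‖u‖ ^ 2 = 2 * α * c * ‖u‖ ^ (α - 2) := by
    rw [r1]; field_simp
  rw [r4] at hmain
  have hmul := mul_le_mul_of_nonneg_left hmain
    (show 0 ≤ p * ‖u‖ ^ (p - 2) by positivity)
  rw [r3, real_inner_smul_left, real_inner_smul_left, mul_pow, mul_pow, r2, hX2, hY2]
  simp only [hin]
  generalize ‖u‖ ^ α = S at *
  generalize ‖u‖ ^ (α - 2) = N at *
  generalize ‖u‖ ^ (p - 2) = M at *
  -- The pure second derivatives are solved in terms of the mixed one, `W`, which cancels in the sum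
  -- `A + D`.
  have t1 : A.re = W.im + 2 * c * (α * (N * (u.re * X.re + u.im * X.im))) := by linarith
  have t2 : D.im = W.re - 2 * c * (α * (N * (u.re * Y.re + u.im * Y.im))) := by linarith
  have t3 : A.im = - W.re := by linarith
  have t4 : D.re = - W.im := by linarith
  rw [t1, t2, t3, t4]
  refine le_of_eq_of_le ?_ (hmul.trans_eq ?_)
  · ring
  · ring

end Pointwise

/-! ### Polar coordinates and the radial mass -/

section Polar

variable {E : Type*} [NormedAddCommGroup E] [NormedSpace ℝ E] [FiniteDimensional ℝ E]
  [Nontrivial E] [MeasurableSpace E] [BorelSpace E]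

/-- Integration in polar coordinates. -/
theorem lintegral_eq_lintegral_toSphere (μ : Measure E) [μ.IsAddHaarMeasure] {F : E → ℝ≥0∞}
    (hF : Measurable F) :
    ∫⁻ x, F x ∂μ = ∫⁻ t : Set.Ioi (0 : ℝ), ∫⁻ ζ : sphere (0 : E) 1, F ((t : ℝ) • (ζ : E))
      ∂μ.toSphere ∂(Measure.volumeIoiPow (Module.finrank ℝ E - 1)) := by
  have hm : Measurable fun y : sphere (0 : E) 1 × Set.Ioi (0 : ℝ) =>
      F ((y.2 : ℝ) • (y.1 : E)) := hF.comp (by fun_prop)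
  have h0 : ∫⁻ x, F x ∂μ = ∫⁻ x : ({0}ᶜ : Set E), F x ∂(μ.comap (↑)) := by
    rw [lintegral_subtype_comap (measurableSet_singleton _).compl F, restrict_compl_singleton]
  rw [h0, ← lintegral_prod_symm' _ hm,
    ← (μ.measurePreserving_homeomorphUnitSphereProd).lintegral_comp hm]
  refine lintegral_congr fun x => ?_
  congr 1
  have hx : ‖(x : E)‖ ≠ 0 := norm_ne_zero_iff.2 x.2
  simp [smul_smul, hx]

/-- A weighted integral over the ball is controlled by the integral means over the spheres. -/
theorem lintegral_radial_mul_le (μ : Measure E) [μ.IsAddHaarMeasure] {k : ℝ → ℝ} {G : E → ℝ≥0∞}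
    {M : ℝ≥0∞} (hk : Measurable k) (hk0 : ∀ t, 1 ≤ t → k t = 0)
    (hF : Measurable fun z => ENNReal.ofReal (k ‖z‖) * G z)
    (hM : ∀ r ∈ Set.Ioo (0 : ℝ) 1, ∫⁻ ζ : sphere (0 : E) 1, G (r • (ζ : E)) ∂μ.toSphere ≤ M) :
    ∫⁻ z, ENNReal.ofReal (k ‖z‖) * G z ∂μ ≤
      (∫⁻ t in Set.Ioo (0 : ℝ) 1, ENNReal.ofReal (t ^ (Module.finrank ℝ E - 1)) *
        ENNReal.ofReal (k t)) * M := by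
  rw [lintegral_eq_lintegral_toSphere μ hF]
  have h1 : ∀ t : Set.Ioi (0 : ℝ), ∫⁻ ζ : sphere (0 : E) 1,
      ENNReal.ofReal (k ‖(t : ℝ) • (ζ : E)‖) * G ((t : ℝ) • (ζ : E)) ∂μ.toSphere ≤
      ENNReal.ofReal (k t) * M := by
    intro t
    have ht : (0 : ℝ) < t := t.2
    have h2 : ∀ ζ : sphere (0 : E) 1, ‖(t : ℝ) • (ζ : E)‖ = t := fun ζ => by
      rw [norm_smul, norm_eq_of_mem_sphere, mul_one, Real.norm_of_nonneg ht.le]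
    simp_rw [h2]
    rcases lt_or_ge (t : ℝ) 1 with h | h
    · rw [lintegral_const_mul' _ _ ENNReal.ofReal_ne_top]
      gcongr
      exact hM t ⟨ht, h⟩
    · simp [hk0 t h]
  refine (lintegral_mono h1).trans ?_
  have hk' : Measurable fun t : ℝ => ENNReal.ofReal (k t) := hk.ennreal_ofReal
  rw [lintegral_mul_const _ (by fun_prop)]
  gcongr
  rw [Measure.volumeIoiPow, lintegral_withDensity_eq_lintegral_mul _ (by fun_prop) (by fun_prop)]
  simp only [Pi.mul_apply]
  rw [lintegral_subtype_comap measurableSet_Ioi (fun t : ℝ =>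
    ENNReal.ofReal (t ^ (Module.finrank ℝ E - 1)) * ENNReal.ofReal (k t)),
    ← Set.Ioo_union_Ici_eq_Ioi zero_lt_one]
  refine (lintegral_union_le _ _ _).trans_eq ?_
  rw [setLIntegral_congr_fun (g := fun _ => 0) measurableSet_Ici fun t ht => by simp [hk0 t ht]]
  simp

/-- The radial weight `4 t² H''(1 - t²)` has bounded mass in dimension at least two. -/
theorem lintegral_radial_weight_le {H₁ H₂ : ℝ → ℝ} (hd : ∀ s, HasDerivAt H₁ (H₂ s) s)
    (hc : Continuous H₂) (h₁ : ∀ s, 0 ≤ H₁ s ∧ H₁ s ≤ 1) (h₂ : ∀ s, 0 ≤ H₂ s) (d : ℕ) :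
    ∫⁻ t in Set.Ioo (0 : ℝ) 1, ENNReal.ofReal (t ^ d) *
      ENNReal.ofReal (4 * t ^ 2 * H₂ (1 - t ^ 2)) ≤ 2 := by
  have hcont : Continuous fun t : ℝ => 4 * t * H₂ (1 - t ^ 2) := by fun_prop
  calc _ ≤ ∫⁻ t in Set.Ioo (0 : ℝ) 1, ENNReal.ofReal (4 * t * H₂ (1 - t ^ 2)) := by
        refine setLIntegral_mono (by fun_prop) fun t ht => ?_
        have ht0 : 0 ≤ t := ht.1.le
        rw [← ENNReal.ofReal_mul (by positivity)]
        refine ENNReal.ofReal_le_ofReal ?_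
        have h3 : t ^ d ≤ 1 := pow_le_one₀ ht0 ht.2.le
        -- Lowering `t²` to `t` makes the integrand the exact derivative of `-2 H₁(1 - t²)`.
        have h4 : t ^ 2 ≤ t := by nlinarith [ht.2]
        have h5 : 0 ≤ t ^ d := by positivity
        have := h₂ (1 - t ^ 2)
        calc t ^ d * (4 * t ^ 2 * H₂ (1 - t ^ 2)) ≤ 1 * (4 * t * H₂ (1 - t ^ 2)) := by gcongr
          _ = _ := one_mul _
    _ = ENNReal.ofReal (∫ t in Set.Ioo (0 : ℝ) 1, 4 * t * H₂ (1 - t ^ 2)) := by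
        rw [ofReal_integral_eq_lintegral_ofReal]
        · exact (hcont.integrableOn_Icc (a := 0) (b := 1)).mono_set Set.Ioo_subset_Icc_self
        · filter_upwards [ae_restrict_mem measurableSet_Ioo] with t ht
          have := h₂ (1 - t ^ 2)
          have := ht.1
          positivity
    _ ≤ ENNReal.ofReal 2 := by
        refine ENNReal.ofReal_le_ofReal ?_
        rw [← integral_Ioc_eq_integral_Ioo, ← intervalIntegral.integral_of_le zero_le_one,
          intervalIntegral.integral_eq_sub_of_hasDerivAt (f := fun t => -2 * H₁ (1 - t ^ 2))
            _ (hcont.intervalIntegrable _ _)]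
        · norm_num
          linarith [h₁ 0, h₁ 1]
        · intro t _
          have := (((hd (1 - t ^ 2)).comp t (((hasDerivAt_id t).pow 2).const_sub 1))).const_mul (-2)
          refine this.congr_deriv ?_
          simp
          ring
    _ = 2 := by simp

end Polar

/-! ### Directional derivatives of the radial cutoff -/

section RadialCutoff

open scoped RealInnerProductSpace

variable {E : Type*} [NormedAddCommGroup E] [InnerProductSpace ℝ E]

theorem hasLineDerivAt_radial {H H₁ : ℝ → ℝ} (hd : ∀ s, HasDerivAt H (H₁ s) s) (z e : E) :
    HasLineDerivAt ℝ (fun w => H (1 - ‖w‖ ^ 2)) (H₁ (1 - ‖z‖ ^ 2) * (-2 * ⟪z, e⟫)) z e := by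
  have h := ((hd _).comp_hasFDerivAt z (((hasFDerivAt_id z).norm_sq).const_sub 1)).hasLineDerivAt e
  refine HasDerivAt.congr_deriv h ?_
  simp

theorem hasLineDerivAt_radial_mul_inner {H₁ H₂ : ℝ → ℝ} (hd : ∀ s, HasDerivAt H₁ (H₂ s) s)
    (z e : E) :
    HasLineDerivAt ℝ (fun w => H₁ (1 - ‖w‖ ^ 2) * (-2 * ⟪w, e⟫))
      (H₂ (1 - ‖z‖ ^ 2) * (4 * ⟪z, e⟫ ^ 2) - 2 * H₁ (1 - ‖z‖ ^ 2) * ‖e‖ ^ 2) z e := by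
  have h1 : HasDerivAt _ _ _ := hasLineDerivAt_radial hd z e
  have h2 : HasDerivAt (fun t : ℝ => ⟪z + t • e, e⟫) (⟪e, e⟫) 0 := by
    have : HasDerivAt (fun t : ℝ => z + t • e) e 0 := by
      simpa using ((hasDerivAt_id (0 : ℝ)).smul_const e).const_add z
    simpa using this.inner ℝ (hasDerivAt_const (0 : ℝ) e)
  refine (h1.mul (h2.const_mul (-2))).congr_deriv ?_
  simp
  ring

end RadialCutoff

/-! ### Green's formula on the ball -/

section Ball

open Filter Topology
open scoped RealInnerProductSpace

variable {n : ℕ}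

theorem isOpen_unitBall : IsOpen (unitBall n) := isOpen_ball

theorem mem_unitBall {z : Cn n} : z ∈ unitBall n ↔ ‖z‖ < 1 := mem_ball_zero_iff

/-- Parseval for the real orthonormal basis `e_k, i e_k`; it assembles the directional terms `4⟪z,
e⟫²` into `4‖z‖²`. -/
theorem sum_inner_single_sq (z : Cn n) :
    ∑ k, (⟪z, EuclideanSpace.single k (1 : ℂ)⟫ ^ 2
      + ⟪z, EuclideanSpace.single k Complex.I⟫ ^ 2) = ‖z‖ ^ 2 := by
  rw [EuclideanSpace.norm_sq_eq]
  refine Finset.sum_congr rfl fun k _ => ?_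
  have h : ∀ c : ℂ, ⟪z, EuclideanSpace.single k c⟫ = (z k).re * c.re + (z k).im * c.im := by
    intro c
    rw [PiLp.inner_apply, Finset.sum_eq_single k]
    · simp [Complex.inner]; ring
    · intro j _ hj
      simp [hj]
    · simp
  rw [h, h, Complex.sq_norm, Complex.normSq_apply]
  simp
  ring

theorem dzbar_eq_fderiv {f : Cn n → ℂ} {z : Cn n} (hf : DifferentiableAt ℝ f z) (k : Fin n) :
    dzbar k f z = (1 / 2 : ℂ) * (fderiv ℝ f z (EuclideanSpace.single k (1 : ℂ))
      + Complex.I * fderiv ℝ f z (EuclideanSpace.single k Complex.I)) := by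
  rw [dzbar, hf.lineDeriv_eq_fderiv, hf.lineDeriv_eq_fderiv]

/-- The radial projection `z/‖z‖` is a competitor; at the origin any unit vector serves, which
requires `n ≥ 1`. Only this upper bound matters, the weight exponent being 1. -/
theorem bdryDist_le (hn : 1 ≤ n) {z : Cn n} (hz : z ∈ unitBall n) : bdryDist z ≤ 1 - ‖z‖ := by
  rw [mem_unitBall] at hz
  have hfr : frontier (unitBall n) = sphere (0 : Cn n) 1 := frontier_ball 0 one_ne_zero
  rw [bdryDist, hfr]
  by_cases h0 : z = 0
  · subst h0
    have hs : EuclideanSpace.single (⟨0, hn⟩ : Fin n) (1 : ℂ) ∈ sphere (0 : Cn n) 1 := by simp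
    refine (infDist_le_dist_of_mem hs).trans ?_
    simp
  · have hz0 : 0 < ‖z‖ := norm_pos_iff.2 h0
    have hs : ‖z‖⁻¹ • z ∈ sphere (0 : Cn n) 1 := by
      simp [norm_smul, hz0.ne']
    refine (infDist_le_dist_of_mem hs).trans_eq ?_
    have h1 : z - ‖z‖⁻¹ • z = (1 - ‖z‖⁻¹) • z := by rw [sub_smul, one_smul]
    have h2 : 1 ≤ ‖z‖⁻¹ := (one_le_inv₀ hz0).2 hz.le
    rw [dist_eq_norm, h1, norm_smul, Real.norm_of_nonpos (by linarith)]
    field_simp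
    ring

theorem isCompact_setOf_le_one_sub_norm_sq {ε : ℝ} (hε : 0 < ε) :
    IsCompact {z : Cn n | ε ≤ 1 - ‖z‖ ^ 2} := by
  refine (isCompact_closedBall (0 : Cn n) 1).of_isClosed_subset
    (isClosed_le continuous_const (by fun_prop)) fun z hz => ?_
  rw [Set.mem_ofPred_eq] at hz
  rw [mem_closedBall_zero_iff]
  nlinarith [norm_nonneg z]

theorem setOf_le_one_sub_norm_sq_subset {ε : ℝ} (hε : 0 < ε) :
    {z : Cn n | ε ≤ 1 - ‖z‖ ^ 2} ⊆ unitBall n := fun z hz => by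
  rw [Set.mem_ofPred_eq] at hz
  rw [mem_unitBall]
  nlinarith [norm_nonneg z]

theorem continuous_radial_mul {ε : ℝ} (hε : 0 < ε) {h : ℝ → ℝ} (hc : Continuous h)
    (h0 : ∀ s ≤ ε, h s = 0) {W : Cn n → ℝ} (hW : ContinuousOn W (unitBall n)) :
    Continuous fun z => h (1 - ‖z‖ ^ 2) * W z :=
  continuous_mul_of_eq_zero_off_compact (isCompact_setOf_le_one_sub_norm_sq hε) isOpen_unitBall
    (setOf_le_one_sub_norm_sq_subset hε) (by fun_prop)
    (fun _ hz => h0 _ (le_of_lt (not_le.1 hz))) hW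

theorem integrable_radial_mul {ε : ℝ} (hε : 0 < ε) {h : ℝ → ℝ} (hc : Continuous h)
    (h0 : ∀ s ≤ ε, h s = 0) {W : Cn n → ℝ} (hW : ContinuousOn W (unitBall n)) :
    Integrable (fun z => h (1 - ‖z‖ ^ 2) * W z) :=
  integrable_mul_of_eq_zero_off_compact (isCompact_setOf_le_one_sub_norm_sq hε) isOpen_unitBall
    (setOf_le_one_sub_norm_sq_subset hε) (by fun_prop)
    (fun _ hz => h0 _ (le_of_lt (not_le.1 hz))) hW

theorem continuousOn_normRpowSndDeriv {f : Cn n → ℂ} (hf : ContDiffOn ℝ 2 f (unitBall n))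
    {p : ℝ} (hp : 2 < p) (e : Cn n) :
    ContinuousOn (fun z => normRpowSndDeriv p (f z) (fderiv ℝ f z e)
      (fderiv ℝ (fun w => fderiv ℝ f w e) z e)) (unitBall n) := by
  have h1 : ContDiffOn ℝ 1 (fun w => fderiv ℝ f w e) (unitBall n) :=
    (hf.fderiv_of_isOpen (m := 1) isOpen_unitBall (by norm_num)).clm_apply contDiffOn_const
  have h2 : ContinuousOn (fun z => fderiv ℝ (fun w => fderiv ℝ f w e) z e) (unitBall n) :=
    (h1.continuousOn_fderiv_of_isOpen isOpen_unitBall le_rfl).clm_apply continuousOn_const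
  exact hf.continuousOn.normRpowSndDeriv hp h1.continuousOn h2

/-- The second derivative of `|f| ^ p`, integrated against a compactly supported radial
function. -/
theorem integral_radial_mul_normRpowSndDeriv_le {f : Cn n → ℂ}
    (hf : ContDiffOn ℝ 2 f (unitBall n))
    {p : ℝ} (hp : 2 < p) {ε : ℝ} (hε : 0 < ε) {H H₁ H₂ : ℝ → ℝ}
    (hd : ∀ s, HasDerivAt H (H₁ s) s) (hd₁ : ∀ s, HasDerivAt H₁ (H₂ s) s) (hc : Continuous H₂)
    (hH₁ : ∀ s, 0 ≤ H₁ s) (h0 : ∀ s ≤ ε, H s = 0 ∧ H₁ s = 0 ∧ H₂ s = 0) (e : Cn n) :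
    ∫ z, H (1 - ‖z‖ ^ 2) * normRpowSndDeriv p (f z) (fderiv ℝ f z e)
      (fderiv ℝ (fun w => fderiv ℝ f w e) z e) ≤
    ∫ z, H₂ (1 - ‖z‖ ^ 2) * (4 * ⟪z, e⟫ ^ 2 * ‖f z‖ ^ p) := by
  have hfc := hf.continuousOn
  have hcH : Continuous H := continuous_iff_continuousAt.2 fun s => (hd s).continuousAt
  have hcH₁ : Continuous H₁ := continuous_iff_continuousAt.2 fun s => (hd₁ s).continuousAt
  have hat : ∀ z ∈ unitBall n, ContDiffAt ℝ 2 f z := fun z hz =>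
    hf.contDiffAt (isOpen_unitBall.mem_nhds hz)
  have hfp : ContinuousOn (fun z => ‖f z‖ ^ p) (unitBall n) :=
    hfc.norm.rpow_const fun _ _ => Or.inr (by linarith)
  have hf1 : ContinuousOn (fun z => fderiv ℝ f z e) (unitBall n) := fun z hz =>
    ((hat z hz).differentiableAt_fderiv_apply e).continuousAt.continuousWithinAt
  have hline : ∀ z ∈ unitBall n, HasLineDerivAt ℝ f (fderiv ℝ f z e) z e := fun z hz =>
    ((hat z hz).differentiableAt two_ne_zero).hasFDerivAt.hasLineDerivAt e
  have hline₁ : ∀ z ∈ unitBall n, HasLineDerivAt ℝ (fun w => fderiv ℝ f w e)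
      (fderiv ℝ (fun w => fderiv ℝ f w e) z e) z e := fun z hz =>
    ((hat z hz).differentiableAt_fderiv_apply e).hasFDerivAt.hasLineDerivAt e
  have hout : ∀ z ∉ {z : Cn n | ε ≤ 1 - ‖z‖ ^ 2}, 1 - ‖z‖ ^ 2 ≤ ε := fun _ hz =>
    le_of_lt (not_le.1 hz)
  rw [integral_mul_lineDeriv_lineDeriv (isCompact_setOf_le_one_sub_norm_sq hε) isOpen_unitBall
    (setOf_le_one_sub_norm_sq_subset hε)
    (φ := fun z => H (1 - ‖z‖ ^ 2))
    (φ₁ := fun z => H₁ (1 - ‖z‖ ^ 2) * (-2 * ⟪z, e⟫))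
    (φ₂ := fun z => H₂ (1 - ‖z‖ ^ 2) * (4 * ⟪z, e⟫ ^ 2) - 2 * H₁ (1 - ‖z‖ ^ 2) * ‖e‖ ^ 2)
    (h := fun z => ‖f z‖ ^ p)
    (h₁ := fun z => p * ‖f z‖ ^ (p - 2) * ⟪f z, fderiv ℝ f z e⟫) (e := e)
    (by fun_prop) (by fun_prop) (by fun_prop)
    (fun z hz => (h0 _ (hout z hz)).1) (fun z hz => by simp [(h0 _ (hout z hz)).2.1])
    (fun z hz => by simp [(h0 _ (hout z hz)).2.1, (h0 _ (hout z hz)).2.2])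
    (fun z => hasLineDerivAt_radial hd z e) (fun z => hasLineDerivAt_radial_mul_inner hd₁ z e)
    hfp ?_ (continuousOn_normRpowSndDeriv hf hp e) ?_ ?_]
  · have i1 := integrable_radial_mul hε hcH₁ (fun s hs => (h0 s hs).2.1)
      (W := fun z => 2 * ‖e‖ ^ 2 * ‖f z‖ ^ p) (by fun_prop)
    have i2 := integrable_radial_mul hε hc (fun s hs => (h0 s hs).2.2)
      (W := fun z => 4 * ⟪z, e⟫ ^ 2 * ‖f z‖ ^ p) (by fun_prop)
    -- The term carrying `-2 H₁ ‖e‖²` is discarded by its sign.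
    refine integral_mono ((i2.sub i1).congr (Eventually.of_forall fun z => ?_)) i2 fun z => ?_
    · simp only [Pi.sub_apply]; ring
    · have h3 := hH₁ (1 - ‖z‖ ^ 2)
      have h4 : 0 ≤ 2 * H₁ (1 - ‖z‖ ^ 2) * ‖e‖ ^ 2 * ‖f z‖ ^ p := by positivity
      simp only
      linarith
  · have : ContinuousOn (fun z => ‖f z‖ ^ (p - 2)) (unitBall n) :=
      hfc.norm.rpow_const fun _ _ => Or.inr (by linarith)
    fun_prop
  · intro z hz
    have := HasDerivAt.norm_rpow_of_one_lt (p := p) (by linarith) (hline z hz)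
    simp only [zero_smul, add_zero] at this
    exact this
  · intro z hz
    have h1 : HasDerivAt (fun t : ℝ => f (z + t • e)) (fderiv ℝ f (z + (0 : ℝ) • e) e) 0 := by
      rw [zero_smul, add_zero]
      exact hline z hz
    have := hasDerivAt_norm_rpow_mul_inner hp (γ := fun t : ℝ => f (z + t • e))
      (γ₁ := fun t : ℝ => fderiv ℝ f (z + t • e) e) h1 (hline₁ z hz)
    simp only [zero_smul, add_zero] at this
    exact this

/-- The cut-off form of the Bergman estimate. -/
theorem integral_radial_mul_norm_rpow_le {f : Cn n → ℂ} (hf : ContDiffOn ℝ 2 f (unitBall n))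
    {p α : ℝ} (hp : 2 < p) (hα : 0 ≤ α) {lam : Fin n → ℝ}
    (hpde : ∀ k : Fin n, ∀ z ∈ unitBall n, dzbar k f z = ((lam k * ‖f z‖ ^ α : ℝ) : ℂ))
    {ε : ℝ} (hε : 0 < ε) {H H₁ H₂ : ℝ → ℝ}
    (hd : ∀ s, HasDerivAt H (H₁ s) s) (hd₁ : ∀ s, HasDerivAt H₁ (H₂ s) s) (hc : Continuous H₂)
    (hH : ∀ s, 0 ≤ H s) (hH₁ : ∀ s, 0 ≤ H₁ s)
    (h0 : ∀ s ≤ ε, H s = 0 ∧ H₁ s = 0 ∧ H₂ s = 0) :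
    p * (4 - (α - 2) ^ 2 / p) * (∑ k, lam k ^ 2) *
      ∫ z, H (1 - ‖z‖ ^ 2) * ‖f z‖ ^ (p + 2 * α - 2) ≤
    ∫ z, 4 * ‖z‖ ^ 2 * H₂ (1 - ‖z‖ ^ 2) * ‖f z‖ ^ p := by
  have hfc := hf.continuousOn
  have hcH : Continuous H := continuous_iff_continuousAt.2 fun s => (hd s).continuousAt
  have hfp : ContinuousOn (fun z => ‖f z‖ ^ p) (unitBall n) :=
    hfc.norm.rpow_const fun _ _ => Or.inr (by linarith)
  have hfq : ContinuousOn (fun z => ‖f z‖ ^ (p + 2 * α - 2)) (unitBall n) :=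
    hfc.norm.rpow_const fun _ _ => Or.inr (by linarith)
  have hat : ∀ z ∈ unitBall n, ContDiffAt ℝ 2 f z := fun z hz =>
    hf.contDiffAt (isOpen_unitBall.mem_nhds hz)
  have hint₂ : ∀ e : Cn n, Integrable (fun z => H₂ (1 - ‖z‖ ^ 2) * (4 * ⟪z, e⟫ ^ 2 * ‖f z‖ ^ p)) :=
    fun e => integrable_radial_mul hε hc (fun s hs => (h0 s hs).2.2) (by fun_prop)
  have hint : ∀ e : Cn n, Integrable (fun z => H (1 - ‖z‖ ^ 2) * normRpowSndDeriv p (f z)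
      (fderiv ℝ f z e) (fderiv ℝ (fun w => fderiv ℝ f w e) z e)) := fun e =>
    integrable_radial_mul hε hcH (fun s hs => (h0 s hs).1) (continuousOn_normRpowSndDeriv hf hp e)
  have hle := fun e => integral_radial_mul_normRpowSndDeriv_le hf hp hε hd hd₁ hc hH₁ h0 e
  have hk : ∀ k, p * (4 - (α - 2) ^ 2 / p) * lam k ^ 2 *
      ∫ z, H (1 - ‖z‖ ^ 2) * ‖f z‖ ^ (p + 2 * α - 2) ≤
      ∫ z, H₂ (1 - ‖z‖ ^ 2) * (4 * (⟪z, EuclideanSpace.single k (1 : ℂ)⟫ ^ 2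
        + ⟪z, EuclideanSpace.single k Complex.I⟫ ^ 2) * ‖f z‖ ^ p) := by
    intro k
    have e1 := hle (EuclideanSpace.single k (1 : ℂ))
    have e2 := hle (EuclideanSpace.single k Complex.I)
    have e3 := add_le_add e1 e2
    rw [← integral_add (hint _) (hint _), ← integral_add (hint₂ _) (hint₂ _)] at e3
    refine le_trans ?_ (e3.trans_eq ?_)
    · rw [← integral_const_mul]
      refine integral_mono ((integrable_radial_mul hε hcH (fun s hs => (h0 s hs).1)
        hfq).const_mul _) ((hint _).add (hint _)) fun z => ?_
      by_cases hz : z ∈ unitBall n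
      · have key := normRpowSndDeriv_add_ge (hat z hz) (EuclideanSpace.single k (1 : ℂ))
          (EuclideanSpace.single k Complex.I) hp hα (c := lam k) (by
            filter_upwards [isOpen_unitBall.mem_nhds hz] with w hw
            rw [← hpde k w hw, dzbar_eq_fderiv ((hat w hw).differentiableAt two_ne_zero)])
        have := mul_le_mul_of_nonneg_left key (hH (1 - ‖z‖ ^ 2))
        simp only
        linarith
      · have : H (1 - ‖z‖ ^ 2) = 0 := (h0 _ (by
          rw [mem_unitBall, not_lt] at hz
          nlinarith)).1
        simp [this]
    · refine integral_congr_ae (Eventually.of_forall fun z => ?_)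
      simp only
      ring
  have hsum := Finset.sum_le_sum fun k (_ : k ∈ Finset.univ) => hk k
  rw [← Finset.sum_mul, ← Finset.mul_sum, ← integral_finsetSum] at hsum
  · refine hsum.trans_eq (integral_congr_ae (Eventually.of_forall fun z => ?_))
    simp only
    rw [← Finset.mul_sum, ← Finset.sum_mul, ← Finset.mul_sum, sum_inner_single_sq]
    ring
  · intro k _
    exact integrable_radial_mul hε hc (fun s hs => (h0 s hs).2.2) (by fun_prop)

end Ball

/-! ### Hardy bound, removal of the cutoff, conclusion -/

section Main

open Filter Topology

variable {n : ℕ}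

/-- Functions in the Hardy space have bounded spherical means for the unnormalized surface
measure. -/
theorem MemHardy.exists_lintegral_toSphere_le {f : Cn n → ℂ} {p : ℝ} (hp : 0 < p)
    (hf : MemHardy (ENNReal.ofReal p) f) :
    ∃ M : ℝ≥0∞, M ≠ ∞ ∧ ∀ r ∈ Set.Ioo (0 : ℝ) 1,
      ∫⁻ ζ : sphere (0 : Cn n) 1, ‖f (r • (ζ : Cn n))‖ₑ ^ p
        ∂(volume : Measure (Cn n)).toSphere ≤ M := by
  set c := (volume : Measure (Cn n)).toSphere Set.univ with hc
  have hcf : c ≠ ∞ := measure_ne_top _ _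
  have hN := hf.norm_lt_top
  rw [hardyNorm, if_neg ENNReal.ofReal_ne_top, ENNReal.toReal_ofReal hp.le] at hN
  set N := ⨆ r ∈ Set.Ioo (0 : ℝ) 1, integralMean p r f with hNdef
  refine ⟨c * N ^ p, ENNReal.mul_ne_top hcf (ENNReal.rpow_ne_top_of_nonneg hp.le hN.ne),
    fun r hr => ?_⟩
  by_cases hc0 : c = 0
  · have : (volume : Measure (Cn n)).toSphere = 0 := Measure.measure_univ_eq_zero.1 hc0
    simp [this]
  have h1 : integralMean p r f ≤ N := le_iSup₂ (f := fun r (_ : r ∈ Set.Ioo (0 : ℝ) 1) =>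
    integralMean p r f) r hr
  rw [integralMean, one_div, ENNReal.rpow_inv_le_iff hp, surfN, lintegral_smul_measure,
    smul_eq_mul, ← hc] at h1
  rwa [ENNReal.inv_mul_le_iff hc0 hcf] at h1

/-- The weighted integral of `|f| ^ (p + 2 α - 2)` over the ball is finite. -/
theorem lintegral_one_sub_norm_sq_mul_lt_top (hn : 1 ≤ n) {lam : Fin n → ℝ}
    (hlam : ∑ k, lam k ^ 2 ≠ 0) {α p : ℝ} (hα : 0 ≤ α) (hp2 : 2 < p)
    (hp : (α - 2) ^ 2 / 4 < p) {f : Cn n → ℂ} (hfH : MemHardy (ENNReal.ofReal p) f)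
    (hf : ContDiffOn ℝ 2 f (unitBall n))
    (hpde : ∀ k : Fin n, ∀ z ∈ unitBall n, dzbar k f z = ((lam k * ‖f z‖ ^ α : ℝ) : ℂ)) :
    ∫⁻ z in unitBall n, ENNReal.ofReal ((1 - ‖z‖ ^ 2) * ‖f z‖ ^ (p + 2 * α - 2)) < ∞ := by
  have hfc := hf.continuousOn
  have hfp : ContinuousOn (fun z => ‖f z‖ ^ p) (unitBall n) :=
    hfc.norm.rpow_const fun _ _ => Or.inr (by linarith)
  have hfq : ContinuousOn (fun z => ‖f z‖ ^ (p + 2 * α - 2)) (unitBall n) :=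
    hfc.norm.rpow_const fun _ _ => Or.inr (by linarith)
  have : Nontrivial (Cn n) := by
    have : Nonempty (Fin n) := ⟨⟨0, hn⟩⟩
    infer_instance
  obtain ⟨M, hM, hMle⟩ := hfH.exists_lintegral_toSphere_le (by linarith)
  set C := p * (4 - (α - 2) ^ 2 / p) * ∑ k, lam k ^ 2 with hC
  have hC0 : 0 < C := by
    have h1 : 0 < ∑ k, lam k ^ 2 :=
      lt_of_le_of_ne (Finset.sum_nonneg fun _ _ => sq_nonneg _) hlam.symm
    have h2 : (α - 2) ^ 2 / p < 4 := by
      rw [div_lt_iff₀ (by linarith)]; linarith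
    have h3 : 0 < 4 - (α - 2) ^ 2 / p := by linarith
    positivity
  set Q := (ENNReal.ofReal C)⁻¹ * (2 * M) with hQ
  have hQt : Q < ∞ := ENNReal.mul_lt_top (ENNReal.inv_lt_top.2 (ENNReal.ofReal_pos.2 hC0))
    (ENNReal.mul_lt_top ENNReal.ofNat_lt_top hM.lt_top)
  have hcut := fun m : ℕ => exists_convex_cutoff (ε := 1 / ((m : ℝ) + 1)) (by positivity)
  choose H H₁ H₂ hd hd₁ hc hH hH₁ hH₂ h0 hlow hup using hcut
  have hcH : ∀ m, Continuous (H m) := fun m =>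
    continuous_iff_continuousAt.2 fun s => (hd m s).continuousAt
  have hbound : ∀ m, ∫⁻ z in unitBall n,
      ENNReal.ofReal (H m (1 - ‖z‖ ^ 2) * ‖f z‖ ^ (p + 2 * α - 2)) ≤ Q := by
    intro m
    have hε : (0 : ℝ) < 1 / ((m : ℝ) + 1) := by positivity
    have key := integral_radial_mul_norm_rpow_le hf hp2 hα hpde hε (hd m) (hd₁ m) (hc m) (hH m)
      (fun s => (hH₁ m s).1) (h0 m)
    rw [← hC] at key
    have i1 := integrable_radial_mul hε (hcH m) (fun s hs => (h0 m s hs).1) hfq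
    have i2' := integrable_radial_mul hε (hc m) (fun s hs => (h0 m s hs).2.2)
      (W := fun z => 4 * ‖z‖ ^ 2 * ‖f z‖ ^ p) (by fun_prop)
    have c2' := continuous_radial_mul hε (hc m) (fun s hs => (h0 m s hs).2.2)
      (W := fun z => 4 * ‖z‖ ^ 2 * ‖f z‖ ^ p) (by fun_prop)
    have heq : (fun z : Cn n => H₂ m (1 - ‖z‖ ^ 2) * (4 * ‖z‖ ^ 2 * ‖f z‖ ^ p)) =
        fun z => 4 * ‖z‖ ^ 2 * H₂ m (1 - ‖z‖ ^ 2) * ‖f z‖ ^ p := by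
      ext z; ring
    rw [heq] at i2' c2'
    have key' := ENNReal.ofReal_le_ofReal key
    rw [ENNReal.ofReal_mul hC0.le,
      ofReal_integral_eq_lintegral_ofReal i1 (Eventually.of_forall fun z =>
        mul_nonneg (hH m _) (by positivity)),
      ofReal_integral_eq_lintegral_ofReal i2' (Eventually.of_forall fun z =>
        mul_nonneg (mul_nonneg (by positivity) (hH₂ m _)) (by positivity))] at key'
    have hsplit : ∀ z : Cn n, ENNReal.ofReal (4 * ‖z‖ ^ 2 * H₂ m (1 - ‖z‖ ^ 2) * ‖f z‖ ^ p) =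
        ENNReal.ofReal (4 * ‖z‖ ^ 2 * H₂ m (1 - ‖z‖ ^ 2)) * ‖f z‖ₑ ^ p := fun z => by
      rw [ENNReal.ofReal_mul (mul_nonneg (by positivity) (hH₂ m _)),
        ← ENNReal.ofReal_rpow_of_nonneg (norm_nonneg _) (by linarith), ofReal_norm]
    -- Nothing is known of `f` off the ball, so measurability comes from continuity of the cut-off
    -- product.
    have hmeas : Measurable fun z : Cn n =>
        ENNReal.ofReal (4 * ‖z‖ ^ 2 * H₂ m (1 - ‖z‖ ^ 2)) * ‖f z‖ₑ ^ p := by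
      simp_rw [← hsplit]
      exact c2'.measurable.ennreal_ofReal
    have hpolar := lintegral_radial_mul_le (volume : Measure (Cn n))
      (k := fun t => 4 * t ^ 2 * H₂ m (1 - t ^ 2)) (G := fun z => ‖f z‖ₑ ^ p) (M := M)
      (by have := hc m; fun_prop)
      (fun t ht => by
        have : H₂ m (1 - t ^ 2) = 0 := (h0 m _ (by nlinarith)).2.2
        simp [this]) hmeas hMle
    simp_rw [hsplit] at key'
    have hw := lintegral_radial_weight_le (hd₁ m) (hc m) (hH₁ m) (hH₂ m)
      (Module.finrank ℝ (Cn n) - 1)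
    refine (setLIntegral_le_lintegral _ _).trans ?_
    rw [hQ, ← ENNReal.div_eq_inv_mul, ENNReal.le_div_iff_mul_le
      (Or.inl (ENNReal.ofReal_pos.2 hC0).ne') (Or.inl ENNReal.ofReal_ne_top), mul_comm]
    exact key'.trans (hpolar.trans (by gcongr))
  refine lt_of_le_of_lt ?_ hQt
  have hlim : ∀ z ∈ unitBall n, Tendsto (fun m =>
      ENNReal.ofReal (H m (1 - ‖z‖ ^ 2) * ‖f z‖ ^ (p + 2 * α - 2))) atTop
      (𝓝 (ENNReal.ofReal ((1 - ‖z‖ ^ 2) * ‖f z‖ ^ (p + 2 * α - 2)))) := by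
    intro z hz
    rw [mem_unitBall] at hz
    have hs : 0 ≤ 1 - ‖z‖ ^ 2 := by nlinarith [norm_nonneg z]
    refine ENNReal.tendsto_ofReal (Tendsto.mul_const _ ?_)
    refine tendsto_of_tendsto_of_tendsto_of_le_of_le ?_ tendsto_const_nhds
      (fun m => hlow m _) (fun m => hup m _ hs)
    have := (tendsto_one_div_add_atTop_nhds_zero_nat (𝕜 := ℝ)).const_mul 2 |>.const_sub
      (1 - ‖z‖ ^ 2)
    simpa using this
  -- Fatou, with `Q` independent of `m`.
  calc _ = ∫⁻ z in unitBall n, liminf (fun m =>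
        ENNReal.ofReal (H m (1 - ‖z‖ ^ 2) * ‖f z‖ ^ (p + 2 * α - 2))) atTop :=
        setLIntegral_congr_fun isOpen_unitBall.measurableSet fun z hz => ((hlim z hz).liminf_eq).symm
    _ ≤ liminf (fun m => ∫⁻ z in unitBall n,
        ENNReal.ofReal (H m (1 - ‖z‖ ^ 2) * ‖f z‖ ^ (p + 2 * α - 2))) atTop :=
        lintegral_liminf_le fun m => (continuous_radial_mul (by positivity) (hcH m)
          (fun s hs => (h0 m s hs).1) hfq).measurable.ennreal_ofReal
    _ ≤ Q := (liminf_le_liminf (Eventually.of_forall hbound)).trans_eq (by simp)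

end Main

theorem mainTheorem6 (n : ℕ) (hn : 1 ≤ n) (lam : Fin n → ℝ) (hlam : ∑ k, lam k ^ 2 ≠ 0)
    (α p : ℝ) (hα : 0 ≤ α) (hp : max 2 ((α - 2) ^ 2 / 4) < p)
    (f : Cn n → ℂ) (hfH : MemHardy (ENNReal.ofReal p) f)
    (hfC : ContDiffOn ℝ 2 f (unitBall n))
    (hpde : ∀ k : Fin n, ∀ z ∈ unitBall n,
      dzbar k f z = ((lam k * ‖f z‖ ^ α : ℝ) : ℂ)) :
    MemBergman 1 (p + 2 * α - 2) f := by
  obtain ⟨hp2, hpα⟩ := max_lt_iff.1 hp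
  refine ⟨hfC.continuousOn, ?_⟩
  have hfin := lintegral_one_sub_norm_sq_mul_lt_top hn hlam hα hp2 hpα hfH hfC hpde
  have hvol : volume (unitBall n) ≠ 0 := (measure_ball_pos volume (0 : Cn n) one_pos).ne'
  rw [bergmanNorm]
  refine ENNReal.add_lt_top.2 ⟨enorm_lt_top, ENNReal.rpow_lt_top_of_nonneg
    (one_div_nonneg.2 (by linarith)) ?_⟩
  rw [volN, lintegral_smul_measure, smul_eq_mul]
  refine ENNReal.mul_ne_top (ENNReal.inv_ne_top.2 hvol) (ne_top_of_le_ne_top hfin.ne ?_)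
  refine setLIntegral_mono' isOpen_unitBall.measurableSet fun z hz => ?_
  have hz1 := mem_unitBall.1 hz
  have hle : bdryDist z ≤ 1 - ‖z‖ ^ 2 :=
    (bdryDist_le hn hz).trans (by nlinarith [norm_nonneg z])
  rw [Real.rpow_one]
  gcongr
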